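/- Let $N$ be a positive integer and let $\{A(t)\}_{t\ge 0}$ be a family of real $N\times N$ matrices such that every $A(t)$ has nonnegative off-diagonal entries and zero row sums, and such that the entries $a_{ij}(t)$ are measurable and locally integrable functions of $t\in[0,\infty)$. Let $\Phi(t,\tau)$, $t\ge\tau\ge 0$, be the state transition matrix of $\dot x(t)=A(t)x(t)$, given by its Peano–Baker series $$\Phi(t,\tau)=I+\int_\tau^t A(\sigma_1)\,d\sigma_1+\int_\tau^t A(\sigma_1)\int_\tau^{\sigma_1}A(\sigma_2)\,d\sigma_2\,d\sigma_1+\cdots .$$ For $\tau\ge 0$ let $\mathcal N_\tau(A)=\{v\in\mathbb R^N : \lim_{t\to\infty}\Phi(t,\tau)v=0\}$. The dimension of this vector space does not depend on $\tau$; it is called $\mathrm{null}(A)$, and $\mathrm{Rank}(A)=N-\mathrm{null}(A)$. For $t\ge\tau\ge 0$ let $C_{t,\tau}\subset\mathbb R^N$ be the convex hull of the columns of the transpose $\Phi'(t,\tau)$. Then for every $\tau\ge 0$ the polytopes $C_{t,\tau}$ decrease as $t$ increases over $[\tau,\infty)$, and as $t\to\infty$ they converge in the Hausdorff distance to $C_\tau=\bigcap_{t\ge\tau}C_{t,\tau}$,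 which is again a polytope (the convex hull of a finite set). The number $c$ of vertices of $C_\tau$ does not depend on $\tau$, the vertices of $C_\tau$ are linearly independent vectors of $\mathbb R^N$ for every $\tau\ge 0$, and $$\mathrm{Rank}(A)=c.$$ -/

import Mathlib

open Set Filter Topology MeasureTheory

/-- A continuous time chain `{A(t)}_{t ≥ 0}` on `N` individuals: every `A(t)`, `t ≥ 0`, has
nonnegative off-diagonal entries and zero row sums, and the entries are (Lebesgue measurable and)
integrable on compact subsets of `[0, ∞)`. -/
structure IsIntensityChain {N : ℕ} (A : ℝ → Matrix (Fin N) (Fin N) ℝ) : Prop where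
  offDiag_nonneg : ∀ t, 0 ≤ t → ∀ i j, i ≠ j → 0 ≤ A t i j
  row_sum : ∀ t, 0 ≤ t → ∀ i, ∑ j, A t i j = 0
  locallyIntegrable : ∀ i j, LocallyIntegrableOn (fun t => A t i j) (Ici 0) volume

/-- The `n`-th term, at time `t`, of the Peano-Baker series started at time `τ`: the `n`-fold
iterated integral `∫_τ^t A(σ₁) ∫_τ^σ₁ A(σ₂) ⋯ dσ₂ dσ₁` (integrals are taken entrywise). -/
noncomputable def peanoBakerTerm {N : ℕ} (A : ℝ → Matrix (Fin N) (Fin N) ℝ) (τ : ℝ) :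
    ℕ → ℝ → Matrix (Fin N) (Fin N) ℝ
  | 0, _ => 1
  | n + 1, t => Matrix.of fun i j => ∫ σ in τ..t, (A σ * peanoBakerTerm A τ n σ) i j

/-- The state transition matrix `Φ(t, τ)`, `t ≥ τ ≥ 0`, of `x' = A(t) x`, given by its Peano-Baker
series (which converges absolutely for every chain `A`). -/
noncomputable def stateTransition {N : ℕ} (A : ℝ → Matrix (Fin N) (Fin N) ℝ) (t τ : ℝ) :
    Matrix (Fin N) (Fin N) ℝ :=
  ∑' n, peanoBakerTerm A τ n t

/-- The null space of the chain at time `τ`: all `v` with `Φ(t, τ) v → 0` as `t → ∞`. -/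
noncomputable def nullSpace {N : ℕ} (A : ℝ → Matrix (Fin N) (Fin N) ℝ) (τ : ℝ) :
    Submodule ℝ (Fin N → ℝ) where
  carrier := {v | Tendsto (fun t => (stateTransition A t τ).mulVec v) atTop (𝓝 0)}
  add_mem' := by
    intro a b ha hb
    simpa [Matrix.mulVec_add] using Tendsto.add ha hb
  zero_mem' := by simp
  smul_mem' := by
    intro r a ha
    simpa [Matrix.mulVec_smul] using Tendsto.const_smul ha r

/-- The nullity of the chain: the dimension of its null space, which does not depend on the time
and is taken at time `0` here. -/
noncomputable def nullity {N : ℕ} (A : ℝ → Matrix (Fin N) (Fin N) ℝ) : ℕ :=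
  Module.finrank ℝ (nullSpace A 0)

/-- The rank of the chain. -/
noncomputable def chainRank {N : ℕ} (A : ℝ → Matrix (Fin N) (Fin N) ℝ) : ℕ :=
  N - nullity A

/-- `C_{t,τ}`: the convex hull of the columns of the transpose of `Φ(t, τ)`. -/
noncomputable def polytope {N : ℕ} (A : ℝ → Matrix (Fin N) (Fin N) ℝ) (t τ : ℝ) :
    Set (Fin N → ℝ) :=
  convexHull ℝ (range (stateTransition A t τ).transpose.col)

/-- `C_τ`: the limit of the decreasing family `C_{t,τ}`, `t ≥ τ`, that is, its intersection. -/
noncomputable def limitPolytope {N : ℕ} (A : ℝ → Matrix (Fin N) (Fin N) ℝ) (τ : ℝ) :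
    Set (Fin N → ℝ) :=
  ⋂ t ∈ Ici τ, polytope A t τ

/-- The set of vertices of `C_τ`. -/
noncomputable def limitVertices {N : ℕ} (A : ℝ → Matrix (Fin N) (Fin N) ℝ) (τ : ℝ) :
    Set (Fin N → ℝ) :=
  (limitPolytope A τ).extremePoints ℝ

/-! `Φ(t, τ)` is row-stochastic and invertible, and `Φ(t, τ) = Φ(t, s) Φ(s, τ)`. So `C_{t,τ}` is the
image of the standard simplex under `w ↦ w Φ(t, τ)`, and it shrinks as `t` grows. By compactness
some sequence `Φ(u k, τ)` converges to a stochastic `Q`, and `C_τ` is the convex hull of the rows of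
`Q`.

Independence of the vertices (`linearIndependent_limitVertices`): write each vertex as `v = W k v ·
Φ(u k, τ)` with weights tending to `L v`, so `v = L v · Q`. As `v` is extreme, `L v` lives on rows
of `Q` equal to `v`, so different vertices have limit weights with disjoint supports. A relation
among the vertices passes to the `W k v`, because `Φ` is invertible, then to the `L v`, where it
must be trivial.

Rank: stochastic matrices contract the sup norm, so `Φ(t, τ) v → 0` iff `Q v = 0`, iff `v` is
orthogonal to every vertex (`mem_nullSpace_iff`). Rank-nullity then gives the count. -/

section Primitive

/-! ### Calculus of primitives of locally integrable functions. -/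

variable {f g F G : ℝ → ℝ} {τ t : ℝ}

theorem MeasureTheory.LocallyIntegrableOn.intervalIntegrable_Ici
    (hf : LocallyIntegrableOn f (Ici 0) volume) (hτ : 0 ≤ τ) (ht : 0 ≤ t) :
    IntervalIntegrable f volume τ t :=
  (hf.integrableOn_compact_subset (fun _ hx => (le_min hτ ht).trans hx.1)
    isCompact_uIcc).intervalIntegrable

theorem MeasureTheory.LocallyIntegrableOn.mul_continuousOn_Ici
    (hf : LocallyIntegrableOn f (Ici 0) volume) (hg : ContinuousOn g (Ici 0)) :
    LocallyIntegrableOn (fun σ => f σ * g σ) (Ici 0) volume :=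
  hf.mul_continuousOn hg isClosed_Ici.isLocallyClosed

theorem locallyIntegrableOn_finset_sum {ι : Type*} (s : Finset ι) {f : ι → ℝ → ℝ} {S : Set ℝ}
    (hf : ∀ i ∈ s, LocallyIntegrableOn (f i) S volume) :
    LocallyIntegrableOn (fun σ => ∑ i ∈ s, f i σ) S volume := by
  classical
  induction s using Finset.induction_on with
  | empty => simpa using locallyIntegrableOn_zero
  | insert a s ha ih =>
    simp only [Finset.sum_insert ha]
    exact (hf a (by simp)).add (ih fun i hi => hf i (by simp [hi]))

theorem continuousOn_primitive_Ici (hf : LocallyIntegrableOn f (Ici 0) volume) (hτ : 0 ≤ τ) :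
    ContinuousOn (fun t => ∫ σ in τ..t, f σ) (Ici 0) := by
  intro t ht
  rw [mem_Ici] at ht
  have hT : (0 : ℝ) ≤ max τ t + 1 := by positivity
  have h := intervalIntegral.continuousOn_primitive_interval' (a := τ)
    (hf.intervalIntegrable_Ici le_rfl hT)
    (by rw [uIcc_of_le hT]; exact ⟨hτ, (le_max_left _ _).trans (by linarith)⟩)
  rw [uIcc_of_le hT] at h
  have htT : t < max τ t + 1 := (le_max_right τ t).trans_lt (by linarith)
  refine (h t ⟨ht, htT.le⟩).mono_of_mem_nhdsWithin ?_
  filter_upwards [self_mem_nhdsWithin, mem_nhdsWithin_of_mem_nhds (Iio_mem_nhds htT)] with x hx hx'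
  exact ⟨hx, le_of_lt hx'⟩

/-- The product rule, in integrated form, for two primitives of locally integrable functions. -/
theorem integral_mul_add_mul_of_primitive (hf : LocallyIntegrableOn f (Ici 0) volume)
    (hg : LocallyIntegrableOn g (Ici 0) volume) (hτ : 0 ≤ τ)
    (hF : ∀ t, 0 ≤ t → F t = ∫ σ in τ..t, f σ) (hG : ∀ t, 0 ≤ t → G t = ∫ σ in τ..t, g σ)
    (ht : 0 ≤ t) : ∫ σ in τ..t, (f σ * G σ + F σ * g σ) = F t * G t := by
  have hfi := hf.intervalIntegrable_Ici hτ ht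
  have hgi := hg.intervalIntegrable_Ici hτ ht
  have h := AbsolutelyContinuousOnInterval.integral_deriv_mul_eq_sub
    (hfi.absolutelyContinuousOnInterval_intervalIntegral left_mem_uIcc)
    (hgi.absolutelyContinuousOnInterval_intervalIntegral left_mem_uIcc)
  simp only [intervalIntegral.integral_same, mul_zero, sub_zero] at h
  rw [hF t ht, hG t ht, ← h]
  apply intervalIntegral.integral_congr_ae
  filter_upwards [hfi.ae_hasDerivAt_integral, hgi.ae_hasDerivAt_integral] with x hx hx' hxI
  have hxI' := uIoc_subset_uIcc hxI
  have hx0 : 0 ≤ x := (le_min hτ ht).trans hxI'.1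
  rw [(hx hxI' τ left_mem_uIcc).deriv, (hx' hxI' τ left_mem_uIcc).deriv, hF x hx0, hG x hx0]

/-- The scalar Peano-Baker terms are the terms of the exponential series of a primitive. -/
theorem primitive_pow_div_factorial_succ (hf : LocallyIntegrableOn f (Ici 0) volume) (hτ : 0 ≤ τ)
    (n : ℕ) (t : ℝ) (ht : 0 ≤ t) :
    (∫ x in τ..t, f x) ^ (n + 1) / (n + 1).factorial =
      ∫ σ in τ..t, f σ * ((∫ x in τ..σ, f x) ^ n / n.factorial) := by
  have hc := continuousOn_primitive_Ici hf hτ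
  have hli (n : ℕ) : LocallyIntegrableOn
      (fun σ => f σ * ((∫ x in τ..σ, f x) ^ n / n.factorial)) (Ici 0) volume :=
    hf.mul_continuousOn_Ici ((hc.pow n).div_const _)
  induction n generalizing t with
  | zero => simp
  | succ n ih =>
    -- With `P` the primitive, both terms of the product rule for `P · P ^ (n + 1) / (n + 1)!` are
    -- multiples of one integrand, with coefficients `1` and `n + 1`.
    have h := integral_mul_add_mul_of_primitive hf (hli n) hτ (fun _ _ => rfl) ih ht
    have h2 : ∀ σ, f σ * ((∫ x in τ..σ, f x) ^ (n + 1) / (n + 1).factorial) +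
        (∫ x in τ..σ, f x) * (f σ * ((∫ x in τ..σ, f x) ^ n / n.factorial)) =
        (n + 2 : ℝ) * (f σ * ((∫ x in τ..σ, f x) ^ (n + 1) / (n + 1).factorial)) := by
      intro σ
      rw [Nat.factorial_succ]
      push_cast
      have : (n.factorial : ℝ) ≠ 0 := by positivity
      have : (n + 1 : ℝ) ≠ 0 := by positivity
      field_simp
      ring
    simp only [h2, intervalIntegral.integral_const_mul] at h
    have h3 : (n + 2 : ℝ) ≠ 0 := by positivity
    apply mul_left_cancel₀ h3
    rw [h, Nat.factorial_succ (n + 1)]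
    push_cast
    have : ((n + 1).factorial : ℝ) ≠ 0 := by positivity
    field_simp
    ring

end Primitive

/-! ### Convergence, composition and diagonal shifts of the Peano-Baker series. -/

section PeanoBaker

variable {N : ℕ} {A : ℝ → Matrix (Fin N) (Fin N) ℝ} {τ s t : ℝ}

theorem peanoBakerTerm_succ_apply (A : ℝ → Matrix (Fin N) (Fin N) ℝ) (τ : ℝ) (n : ℕ) (t : ℝ)
    (i j : Fin N) : peanoBakerTerm A τ (n + 1) t i j =
      ∫ σ in τ..t, (A σ * peanoBakerTerm A τ n σ) i j := rfl

theorem locallyIntegrableOn_mul_apply {M : ℝ → Matrix (Fin N) (Fin N) ℝ}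
    (hA : ∀ i j, LocallyIntegrableOn (fun t => A t i j) (Ici 0) volume)
    (hM : ∀ i j, ContinuousOn (fun t => M t i j) (Ici 0)) (i j : Fin N) :
    LocallyIntegrableOn (fun t => (A t * M t) i j) (Ici 0) volume := by
  simp only [Matrix.mul_apply]
  exact locallyIntegrableOn_finset_sum _ fun k _ => (hA i k).mul_continuousOn_Ici (hM k j)

theorem continuousOn_peanoBakerTerm
    (hA : ∀ i j, LocallyIntegrableOn (fun t => A t i j) (Ici 0) volume) (hτ : 0 ≤ τ) (n : ℕ)
    (i j : Fin N) : ContinuousOn (fun t => peanoBakerTerm A τ n t i j) (Ici 0) := by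
  induction n generalizing i j with
  | zero => exact continuousOn_const
  | succ n ih => exact continuousOn_primitive_Ici (locallyIntegrableOn_mul_apply hA ih i j) hτ

theorem locallyIntegrableOn_mul_peanoBakerTerm
    (hA : ∀ i j, LocallyIntegrableOn (fun t => A t i j) (Ici 0) volume) (hτ : 0 ≤ τ) (n : ℕ)
    (i j : Fin N) :
    LocallyIntegrableOn (fun t => (A t * peanoBakerTerm A τ n t) i j) (Ici 0) volume :=
  locallyIntegrableOn_mul_apply hA (continuousOn_peanoBakerTerm hA hτ n) i j

theorem locallyIntegrableOn_sum_abs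
    (hA : ∀ i j, LocallyIntegrableOn (fun t => A t i j) (Ici 0) volume) :
    LocallyIntegrableOn (fun t => ∑ i, ∑ j, |A t i j|) (Ici 0) volume :=
  locallyIntegrableOn_finset_sum _ fun i _ => locallyIntegrableOn_finset_sum _ fun j _ =>
    (hA i j).norm

theorem abs_mul_apply_le {B M : Matrix (Fin N) (Fin N) ℝ} {C : ℝ} (hM : ∀ i j, |M i j| ≤ C)
    (i j : Fin N) : |(B * M) i j| ≤ (∑ i, ∑ j, |B i j|) * C := by
  have hC : 0 ≤ C := (abs_nonneg _).trans (hM i j)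
  calc |(B * M) i j| ≤ ∑ k, |B i k * M k j| := by
        rw [Matrix.mul_apply]; exact Finset.abs_sum_le_sum_abs _ _
    _ ≤ ∑ k, |B i k| * C := Finset.sum_le_sum fun k _ => by
        rw [abs_mul]; exact mul_le_mul_of_nonneg_left (hM k j) (abs_nonneg _)
    _ = (∑ k, |B i k|) * C := by rw [Finset.sum_mul]
    _ ≤ _ := mul_le_mul_of_nonneg_right
        (Finset.single_le_sum (f := fun i => ∑ j, |B i j|)
          (fun i _ => Finset.sum_nonneg fun j _ => abs_nonneg _) (Finset.mem_univ i)) hC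

/-- Induction against the scalar exponential series. Times `t < τ` are included because `Φ(τ, t)`
will serve as the inverse of `Φ(t, τ)`. -/
theorem abs_peanoBakerTerm_le
    (hA : ∀ i j, LocallyIntegrableOn (fun t => A t i j) (Ici 0) volume) (hτ : 0 ≤ τ) (n : ℕ)
    (t : ℝ) (ht : 0 ≤ t) (i j : Fin N) :
    |peanoBakerTerm A τ n t i j| ≤
      |(∫ σ in τ..t, ∑ i, ∑ j, |A σ i j|)| ^ n / n.factorial := by
  have hw := locallyIntegrableOn_sum_abs hA
  set w : ℝ → ℝ := fun t => ∑ i, ∑ j, |A t i j| with hwdef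
  have hw0 : ∀ σ, 0 ≤ w σ := fun σ =>
    Finset.sum_nonneg fun i _ => Finset.sum_nonneg fun j _ => abs_nonneg _
  induction n generalizing t i j with
  | zero =>
    by_cases h : i = j <;> simp [peanoBakerTerm, Matrix.one_apply, h]
  | succ n ih =>
    have hcont : ContinuousOn (fun σ => |∫ x in τ..σ, w x| ^ n / n.factorial) (Ici 0) :=
      ((continuousOn_primitive_Ici hw hτ).abs.pow n).div_const _
    have hkey : |∫ σ in τ..t, w σ * (|∫ x in τ..σ, w x| ^ n / n.factorial)| =
        |∫ σ in τ..t, w σ| ^ (n + 1) / (n + 1).factorial := by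
      have h1 : |∫ σ in τ..t, w σ| ^ (n + 1) / (n + 1).factorial =
          |(∫ σ in τ..t, w σ) ^ (n + 1) / (n + 1).factorial| := by
        rw [abs_div, abs_pow, Nat.abs_cast]
      rw [h1, primitive_pow_div_factorial_succ hw hτ n t ht]
      rcases le_total τ t with h | h
      · congr 1
        apply intervalIntegral.integral_congr
        intro σ hσ
        rw [uIcc_of_le h] at hσ
        simp only
        rw [abs_of_nonneg (intervalIntegral.integral_nonneg hσ.1 fun x _ => hw0 x)]
      -- Backwards in time the primitive of `w` is nonpositive, so only a constant sign `(-1) ^ n`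
      -- comes out.
      · have : ∀ σ ∈ uIcc τ t, w σ * (|∫ x in τ..σ, w x| ^ n / n.factorial) =
            (-1) ^ n * (w σ * ((∫ x in τ..σ, w x) ^ n / n.factorial)) := by
          intro σ hσ
          rw [uIcc_of_ge h] at hσ
          have h0 : ∫ x in τ..σ, w x ≤ 0 := by
            rw [intervalIntegral.integral_symm]
            exact neg_nonpos.2 (intervalIntegral.integral_nonneg hσ.2 fun x _ => hw0 x)
          rw [abs_of_nonpos h0, neg_pow]
          ring
        rw [intervalIntegral.integral_congr this, intervalIntegral.integral_const_mul, abs_mul,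
          abs_pow, abs_neg, abs_one, one_pow, one_mul]
    rw [peanoBakerTerm_succ_apply, ← hkey, ← Real.norm_eq_abs]
    refine intervalIntegral.norm_integral_le_abs_of_norm_le ?_
      ((hw.mul_continuousOn_Ici hcont).intervalIntegrable_Ici hτ ht)
    refine (ae_restrict_iff' measurableSet_uIoc).2 (Eventually.of_forall fun σ hσ => ?_)
    exact abs_mul_apply_le (ih σ ((le_min hτ ht).trans hσ.1.le)) i j

theorem summable_norm_peanoBakerTerm
    (hA : ∀ i j, LocallyIntegrableOn (fun t => A t i j) (Ici 0) volume) (hτ : 0 ≤ τ) (ht : 0 ≤ t)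
    (i j : Fin N) : Summable fun n => ‖peanoBakerTerm A τ n t i j‖ :=
  Summable.of_nonneg_of_le (fun _ => norm_nonneg _)
    (fun n => abs_peanoBakerTerm_le hA hτ n t ht i j) (Real.summable_pow_div_factorial _)

theorem stateTransition_apply
    (hA : ∀ i j, LocallyIntegrableOn (fun t => A t i j) (Ici 0) volume) (hτ : 0 ≤ τ) (ht : 0 ≤ t)
    (i j : Fin N) : stateTransition A t τ i j = ∑' n, peanoBakerTerm A τ n t i j := by
  have hs : Summable fun n => peanoBakerTerm A τ n t :=
    Pi.summable.2 fun i => Pi.summable.2 fun j => (summable_norm_peanoBakerTerm hA hτ ht i j).of_norm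
  have h1 := tsum_apply (x := i) hs
  have h2 := tsum_apply (x := j) (Pi.summable.1 hs i)
  exact (congrFun h1 j).trans h2

/-- The degree `n` part of `Φ(t, s) Φ(s, τ)`. Cut the outer integral at `s`: the piece over `[τ, s]`
is the summand with `p.1 = 0`, and the piece over `[s, t]` expands by induction. -/
theorem peanoBakerTerm_eq_sum_antidiagonal
    (hA : ∀ i j, LocallyIntegrableOn (fun t => A t i j) (Ici 0) volume) (hτ : 0 ≤ τ) (hs : 0 ≤ s)
    (n : ℕ) (t : ℝ) (ht : 0 ≤ t) :
    peanoBakerTerm A τ n t = ∑ p ∈ Finset.HasAntidiagonal.antidiagonal n,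
      peanoBakerTerm A s p.1 t * peanoBakerTerm A τ p.2 s := by
  induction n generalizing t with
  | zero => simp [peanoBakerTerm]
  | succ n ih =>
    have hli := fun n => locallyIntegrableOn_mul_peanoBakerTerm hA hτ n
    have hli' := fun n => locallyIntegrableOn_mul_peanoBakerTerm hA hs n
    ext i j
    rw [Finset.Nat.sum_antidiagonal_succ, Matrix.add_apply, Matrix.sum_apply,
      peanoBakerTerm_succ_apply,
      ← intervalIntegral.integral_add_adjacent_intervals
        ((hli n i j).intervalIntegrable_Ici hτ hs) ((hli n i j).intervalIntegrable_Ici hs ht)]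
    have h0 : (peanoBakerTerm A s 0 t * peanoBakerTerm A τ (n + 1) s) i j =
        ∫ σ in τ..s, (A σ * peanoBakerTerm A τ n σ) i j := by
      simp [peanoBakerTerm]
    rw [h0]
    congr 1
    have h1 : ∀ σ ∈ uIcc s t, (A σ * peanoBakerTerm A τ n σ) i j =
        ∑ p ∈ Finset.HasAntidiagonal.antidiagonal n, ∑ k, (A σ * peanoBakerTerm A s p.1 σ) i k *
          peanoBakerTerm A τ p.2 s k j := by
      intro σ hσ
      rw [ih σ ((le_min hs ht).trans hσ.1), Matrix.mul_sum, Matrix.sum_apply]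
      refine Finset.sum_congr rfl fun p _ => ?_
      rw [← Matrix.mul_assoc, Matrix.mul_apply]
    rw [intervalIntegral.integral_congr h1, intervalIntegral.integral_finsetSum]
    · refine Finset.sum_congr rfl fun p _ => ?_
      rw [intervalIntegral.integral_finsetSum]
      · simp only [intervalIntegral.integral_mul_const,
          Matrix.mul_apply (M := peanoBakerTerm A s _ t),
          peanoBakerTerm_succ_apply]
      · exact fun k _ => ((hli' _ _ _).intervalIntegrable_Ici hs ht).mul_const _
    · intro p _
      simpa only [Finset.sum_fn] using IntervalIntegrable.sum Finset.univ fun k _ =>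
        ((hli' p.1 i k).intervalIntegrable_Ici hs ht).mul_const (peanoBakerTerm A τ p.2 s k j)

theorem stateTransition_mul
    (hA : ∀ i j, LocallyIntegrableOn (fun t => A t i j) (Ici 0) volume) (hτ : 0 ≤ τ) (hs : 0 ≤ s)
    (ht : 0 ≤ t) : stateTransition A t s * stateTransition A s τ = stateTransition A t τ := by
  ext i j
  rw [Matrix.mul_apply, stateTransition_apply hA hτ ht]
  have h1 : ∀ k, Summable fun n => ∑ p ∈ Finset.HasAntidiagonal.antidiagonal n,
      peanoBakerTerm A s p.1 t i k * peanoBakerTerm A τ p.2 s k j := fun k =>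
    (summable_norm_sum_mul_antidiagonal_of_summable_norm
      (summable_norm_peanoBakerTerm hA hs ht i k) (summable_norm_peanoBakerTerm hA hτ hs k j)).of_norm
  have h2 : ∀ k, stateTransition A t s i k * stateTransition A s τ k j =
      ∑' n, ∑ p ∈ Finset.HasAntidiagonal.antidiagonal n,
        peanoBakerTerm A s p.1 t i k * peanoBakerTerm A τ p.2 s k j := fun k => by
    rw [stateTransition_apply hA hs ht, stateTransition_apply hA hτ hs]
    exact tsum_mul_tsum_eq_tsum_sum_antidiagonal_of_summable_norm
      (summable_norm_peanoBakerTerm hA hs ht i k) (summable_norm_peanoBakerTerm hA hτ hs k j)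
  simp only [h2]
  rw [← Summable.tsum_finsetSum fun k _ => h1 k]
  refine tsum_congr fun n => ?_
  rw [peanoBakerTerm_eq_sum_antidiagonal hA hτ hs n t ht, Finset.sum_comm, Matrix.sum_apply]
  simp only [Matrix.mul_apply]

theorem peanoBakerTerm_succ_self (A : ℝ → Matrix (Fin N) (Fin N) ℝ) (τ : ℝ) (n : ℕ) :
    peanoBakerTerm A τ (n + 1) τ = 0 := by
  ext i j
  rw [peanoBakerTerm_succ_apply, intervalIntegral.integral_same, Matrix.zero_apply]

theorem stateTransition_self (A : ℝ → Matrix (Fin N) (Fin N) ℝ) (τ : ℝ) :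
    stateTransition A τ τ = 1 := by
  rw [stateTransition, tsum_eq_single 0]
  · rfl
  · intro n hn
    obtain ⟨m, rfl⟩ := Nat.exists_eq_succ_of_ne_zero hn
    exact peanoBakerTerm_succ_self A τ m

/-- Diagonal shifts multiply the Peano-Baker series by a scalar exponential series. -/
theorem peanoBakerTerm_add_smul_one
    (hA : ∀ i j, LocallyIntegrableOn (fun t => A t i j) (Ici 0) volume) {w : ℝ → ℝ}
    (hw : LocallyIntegrableOn w (Ici 0) volume) (hτ : 0 ≤ τ) (n : ℕ) (t : ℝ) (ht : 0 ≤ t) :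
    peanoBakerTerm (fun σ => A σ + w σ • (1 : Matrix (Fin N) (Fin N) ℝ)) τ n t =
      ∑ p ∈ Finset.HasAntidiagonal.antidiagonal n,
        ((∫ σ in τ..t, w σ) ^ p.1 / p.1.factorial) • peanoBakerTerm A τ p.2 t := by
  induction n generalizing t with
  | zero => simp [peanoBakerTerm]
  | succ n ih =>
    set E : ℕ → ℝ → ℝ := fun k t => (∫ σ in τ..t, w σ) ^ k / k.factorial with hE
    have hEc : ∀ k, ContinuousOn (E k) (Ici 0) := fun k =>
      ((continuousOn_primitive_Ici hw hτ).pow k).div_const _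
    have hE0 : ∀ t, E 0 t = 1 := fun t => by simp [hE]
    have hEs : ∀ k t, 0 ≤ t → E (k + 1) t = ∫ σ in τ..t, w σ * E k σ := fun k t ht =>
      primitive_pow_div_factorial_succ hw hτ k t ht
    have hMc := continuousOn_peanoBakerTerm hA hτ
    have hMli := locallyIntegrableOn_mul_peanoBakerTerm hA hτ
    ext i j
    have hI1 : ∀ k l, IntervalIntegrable (fun σ => w σ * E k σ * peanoBakerTerm A τ l σ i j)
        volume τ t := fun k l =>
      ((hw.mul_continuousOn_Ici (hEc k)).mul_continuousOn_Ici (hMc l i j)).intervalIntegrable_Ici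
        hτ ht
    have hI2 : ∀ k l, IntervalIntegrable (fun σ => E k σ * (A σ * peanoBakerTerm A τ l σ) i j)
        volume τ t := fun k l => by
      simpa only [mul_comm] using
        ((hMli l i j).mul_continuousOn_Ici (hEc k)).intervalIntegrable_Ici hτ ht
    have hparts : ∀ k l, (∫ σ in τ..t, w σ * E k σ * peanoBakerTerm A τ (l + 1) σ i j) +
        ∫ σ in τ..t, E (k + 1) σ * (A σ * peanoBakerTerm A τ l σ) i j =
        E (k + 1) t * peanoBakerTerm A τ (l + 1) t i j := fun k l => by
      rw [← intervalIntegral.integral_add (hI1 _ _) (hI2 _ _)]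
      exact integral_mul_add_mul_of_primitive (hw.mul_continuousOn_Ici (hEc k)) (hMli l i j) hτ
        (hEs k) (fun _ _ => rfl) ht
    have hexp : ∀ σ ∈ uIcc τ t, ((A σ + w σ • (1 : Matrix (Fin N) (Fin N) ℝ)) *
        peanoBakerTerm (fun σ => A σ + w σ • (1 : Matrix (Fin N) (Fin N) ℝ)) τ n σ) i j =
        ∑ p ∈ Finset.HasAntidiagonal.antidiagonal n, (w σ * E p.1 σ * peanoBakerTerm A τ p.2 σ i j +
          E p.1 σ * (A σ * peanoBakerTerm A τ p.2 σ) i j) := by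
      intro σ hσ
      rw [ih σ ((le_min hτ ht).trans hσ.1), Matrix.mul_sum, Matrix.sum_apply]
      refine Finset.sum_congr rfl fun p _ => ?_
      rw [Matrix.add_mul, Matrix.mul_smul, Matrix.smul_mul, Matrix.one_mul]
      simp only [Matrix.add_apply, Matrix.smul_apply, smul_eq_mul]
      ring
    rw [peanoBakerTerm_succ_apply, intervalIntegral.integral_congr hexp,
      intervalIntegral.integral_finsetSum fun p _ => (hI1 _ _).add (hI2 _ _)]
    simp only [intervalIntegral.integral_add (hI1 _ _) (hI2 _ _), Finset.sum_add_distrib,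
      Matrix.sum_apply, Matrix.smul_apply, smul_eq_mul]
    change _ = ∑ p ∈ Finset.HasAntidiagonal.antidiagonal (n + 1),
      E p.1 t * peanoBakerTerm A τ p.2 t i j
    cases n with
    | zero =>
      simp only [Finset.Nat.antidiagonal_zero, Finset.sum_singleton, Finset.Nat.sum_antidiagonal_succ,
        hE0, one_mul, mul_one, hEs _ _ ht]
      by_cases hij : i = j <;> simp [peanoBakerTerm, Matrix.one_apply, add_comm, hij]
    | succ n =>
      -- Index `(k, l + 1)` of the first sum pairs with `(k + 1, l)` of the second, and `hparts`
      -- integrates each pair by parts. The unpaired terms, `l = 0` in the first and `k = 0` in the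
      -- second, are the two ends of the antidiagonal.
      rw [Finset.Nat.sum_antidiagonal_succ' (f := fun p =>
          ∫ σ in τ..t, w σ * E p.1 σ * peanoBakerTerm A τ p.2 σ i j),
        Finset.Nat.sum_antidiagonal_succ (f := fun p =>
          ∫ σ in τ..t, E p.1 σ * (A σ * peanoBakerTerm A τ p.2 σ) i j),
        Finset.Nat.antidiagonal_succ_succ']
      simp only [Finset.sum_cons, Finset.sum_map, Function.Embedding.prodMap,
        Function.Embedding.coeFn_mk, Prod.map, Nat.succ_eq_add_one, ← hparts,
        Finset.sum_add_distrib]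
      have e1 : (∫ σ in τ..t, w σ * E (n + 1) σ * peanoBakerTerm A τ 0 σ i j) =
          E (n + 2) t * peanoBakerTerm A τ 0 t i j := by
        rw [hEs _ _ ht, ← intervalIntegral.integral_mul_const]; rfl
      have e2 : (∫ σ in τ..t, E 0 σ * (A σ * peanoBakerTerm A τ (n + 1) σ) i j) =
          E 0 t * peanoBakerTerm A τ (n + 2) t i j := by
        simp only [hE0, one_mul]; rfl
      rw [e1, e2]
      ring

theorem tsum_peanoBakerTerm_add_smul_one
    (hA : ∀ i j, LocallyIntegrableOn (fun t => A t i j) (Ici 0) volume) {w : ℝ → ℝ}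
    (hw : LocallyIntegrableOn w (Ici 0) volume) (hτ : 0 ≤ τ) (ht : 0 ≤ t) (i j : Fin N) :
    ∑' n, peanoBakerTerm (fun σ => A σ + w σ • (1 : Matrix (Fin N) (Fin N) ℝ)) τ n t i j =
      Real.exp (∫ σ in τ..t, w σ) * stateTransition A t τ i j := by
  rw [stateTransition_apply hA hτ ht, Real.exp_eq_exp_ℝ, NormedSpace.exp_eq_tsum_div,
    tsum_mul_tsum_eq_tsum_sum_antidiagonal_of_summable_norm
      (Real.summable_pow_div_factorial _).norm (summable_norm_peanoBakerTerm hA hτ ht i j)]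
  refine tsum_congr fun n => ?_
  rw [peanoBakerTerm_add_smul_one hA hw hτ n t ht, Matrix.sum_apply]
  rfl

theorem peanoBakerTerm_nonneg (hA : ∀ σ, 0 ≤ σ → ∀ i j, 0 ≤ A σ i j) (hτ : 0 ≤ τ) (n : ℕ) (t : ℝ)
    (ht : τ ≤ t) (i j : Fin N) : 0 ≤ peanoBakerTerm A τ n t i j := by
  induction n generalizing t i j with
  | zero => by_cases h : i = j <;> simp [peanoBakerTerm, Matrix.one_apply, h]
  | succ n ih =>
    refine intervalIntegral.integral_nonneg ht fun σ hσ => ?_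
    rw [Matrix.mul_apply]
    exact Finset.sum_nonneg fun k _ =>
      mul_nonneg (hA σ (hτ.trans hσ.1) i k) (ih σ hσ.1 k j)

end PeanoBaker

/-! ### Stochasticity and invertibility of the transition matrix. -/

namespace IsIntensityChain

variable {N : ℕ} {A : ℝ → Matrix (Fin N) (Fin N) ℝ} {τ t : ℝ}

/-- Adding `∑ |a i j|` to the diagonal makes the generator entrywise nonnegative, hence its series
too; the shift only multiplies `Φ` by a positive exponential. -/
theorem stateTransition_nonneg (hA : IsIntensityChain A) (hτ : 0 ≤ τ) (ht : τ ≤ t)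
    (i j : Fin N) : 0 ≤ stateTransition A t τ i j := by
  have hw := locallyIntegrableOn_sum_abs hA.locallyIntegrable
  have hB : ∀ σ, 0 ≤ σ → ∀ i j,
      0 ≤ (A σ + (∑ i, ∑ j, |A σ i j|) • (1 : Matrix (Fin N) (Fin N) ℝ)) i j := by
    intro σ hσ i j
    by_cases hij : i = j
    · subst hij
      have h1 : |A σ i i| ≤ ∑ j, |A σ i j| :=
        Finset.single_le_sum (f := fun j => |A σ i j|) (fun _ _ => abs_nonneg _)
          (Finset.mem_univ i)
      have h2 : ∑ j, |A σ i j| ≤ ∑ i, ∑ j, |A σ i j| :=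
        Finset.single_le_sum (f := fun i => ∑ j, |A σ i j|)
          (fun i _ => Finset.sum_nonneg fun j _ => abs_nonneg _) (Finset.mem_univ i)
      have h3 := neg_abs_le (A σ i i)
      simp only [Matrix.add_apply, Matrix.smul_apply, Matrix.one_apply_eq, smul_eq_mul, mul_one]
      linarith
    · simpa [Matrix.one_apply_ne hij] using hA.offDiag_nonneg σ hσ i j hij
  have h := tsum_peanoBakerTerm_add_smul_one hA.locallyIntegrable hw hτ (hτ.trans ht) i j
  exact nonneg_of_mul_nonneg_right
    (h ▸ tsum_nonneg fun n => peanoBakerTerm_nonneg hB hτ n t ht i j) (Real.exp_pos _)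

theorem sum_peanoBakerTerm_succ_apply (hA : IsIntensityChain A) (hτ : 0 ≤ τ) (n : ℕ)
    (t : ℝ) (ht : 0 ≤ t) (i : Fin N) : ∑ j, peanoBakerTerm A τ (n + 1) t i j = 0 := by
  have hli := locallyIntegrableOn_mul_peanoBakerTerm hA.locallyIntegrable hτ n
  have h0 : ∀ σ ∈ uIcc τ t, ∑ j, (A σ * peanoBakerTerm A τ n σ) i j = 0 := by
    intro σ hσ
    have hσ0 : 0 ≤ σ := (le_min hτ ht).trans hσ.1
    simp only [Matrix.mul_apply]
    rw [Finset.sum_comm]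
    simp only [← Finset.mul_sum]
    cases n with
    | zero => simpa [peanoBakerTerm, Matrix.one_apply] using hA.row_sum σ hσ0 i
    | succ n =>
      exact Finset.sum_eq_zero fun k _ => by
        rw [sum_peanoBakerTerm_succ_apply hA hτ n σ hσ0 k, mul_zero]
  simp only [peanoBakerTerm_succ_apply]
  rw [← intervalIntegral.integral_finsetSum fun j _ => (hli i j).intervalIntegrable_Ici hτ ht,
    intervalIntegral.integral_congr h0, intervalIntegral.integral_zero]

theorem stateTransition_mem_rowStochastic (hA : IsIntensityChain A) (hτ : 0 ≤ τ) (ht : τ ≤ t) :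
    stateTransition A t τ ∈ Matrix.rowStochastic ℝ (Fin N) := by
  have ht0 := hτ.trans ht
  refine Matrix.mem_rowStochastic_iff_sum.2 ⟨hA.stateTransition_nonneg hτ ht, fun i => ?_⟩
  simp only [stateTransition_apply hA.locallyIntegrable hτ ht0]
  rw [← Summable.tsum_finsetSum fun j _ =>
    (summable_norm_peanoBakerTerm hA.locallyIntegrable hτ ht0 i j).of_norm, tsum_eq_single 0]
  · simp [peanoBakerTerm, Matrix.one_apply]
  · intro n hn
    obtain ⟨m, rfl⟩ := Nat.exists_eq_succ_of_ne_zero hn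
    exact hA.sum_peanoBakerTerm_succ_apply hτ m t ht0 i

theorem isUnit_stateTransition (hA : IsIntensityChain A) (hτ : 0 ≤ τ) (ht : 0 ≤ t) :
    IsUnit (stateTransition A t τ) :=
  IsUnit.of_mul_eq_one (stateTransition A τ t) <| by
    rw [stateTransition_mul hA.locallyIntegrable ht hτ ht, stateTransition_self]

end IsIntensityChain

/-! ### Convex hulls, extreme points and stochastic matrices. -/

theorem Matrix.convexHull_range_col_transpose {n m : Type*} [Fintype n] (M : Matrix n m ℝ) :
    convexHull ℝ (range M.transpose.col) = (fun w => Matrix.vecMul w M) '' stdSimplex ℝ n := by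
  classical
  have h := M.vecMulLinear.image_convexHull (range fun i : n => (Pi.single i 1 : n → ℝ))
  rw [convexHull_rangle_single_eq_stdSimplex, ← range_comp] at h
  have h2 : M.vecMulLinear ∘ (fun i : n => (Pi.single i 1 : n → ℝ)) = M.transpose.col := by
    ext i j
    simp [Matrix.col]
  rw [h2] at h
  exact h.symm

/-- An extreme point is only a convex combination of copies of itself. -/
theorem eq_of_mem_extremePoints_of_sum_smul_eq {E ι : Type*} [AddCommGroup E] [Module ℝ E]
    [Fintype ι] {C : Set E} (hC : Convex ℝ C) {v : E} (hv : v ∈ C.extremePoints ℝ) {w : ι → ℝ}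
    (hw : w ∈ stdSimplex ℝ ι) {z : ι → E} (hz : ∀ i, z i ∈ C) (hsum : ∑ i, w i • z i = v) {j : ι}
    (hj : 0 < w j) : z j = v := by
  classical
  by_contra hne
  -- The barycentre of the `z i ≠ v` stays in this convex set, yet the relation forces it to be `v`.
  have hconv : Convex ℝ (C \ {v}) := (hC.mem_extremePoints_iff_convex_sdiff.1 hv).2
  set s : Finset ι := Finset.univ.filter fun i => z i ≠ v
  have hpos : 0 < ∑ i ∈ s, w i := Finset.sum_pos' (fun i _ => hw.1 i) ⟨j, by simp [s, hne], hj⟩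
  have hmem := hconv.centerMass_mem (t := s) (w := w) (z := z) (fun i _ => hw.1 i) hpos
    (fun i hi => ⟨hz i, (Finset.mem_filter.1 hi).2⟩)
  refine hmem.2 ?_
  have hs1 := Finset.sum_filter_add_sum_filter_not Finset.univ (fun i => z i ≠ v) w
  have hs2 := Finset.sum_filter_add_sum_filter_not Finset.univ (fun i => z i ≠ v)
    fun i => w i • z i
  have hs3 : ∑ i with ¬ z i ≠ v, w i • z i = (∑ i with ¬ z i ≠ v, w i) • v := by
    rw [Finset.sum_smul]
    refine Finset.sum_congr rfl fun i hi => ?_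
    rw [not_not.1 (Finset.mem_filter.1 hi).2]
  rw [hw.2] at hs1
  rw [hsum, hs3, eq_sub_iff_add_eq'.2 hs1] at hs2
  have hs4 : ∑ i ∈ s, w i • z i = (∑ i ∈ s, w i) • v := by
    rw [eq_sub_iff_add_eq.2 hs2]
    module
  rw [mem_singleton_iff, Finset.centerMass, hs4, smul_smul, inv_mul_cancel₀ hpos.ne', one_smul]

theorem Matrix.isCompact_rowStochastic {n : Type*} [Fintype n] [DecidableEq n] :
    IsCompact (Matrix.rowStochastic ℝ n : Set (Matrix n n ℝ)) := by
  have h : (Matrix.rowStochastic ℝ n : Set (Matrix n n ℝ)) =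
      Set.pi univ fun _ : n => stdSimplex ℝ n := by
    ext M
    rw [SetLike.mem_coe, Matrix.mem_rowStochastic_iff_sum]
    exact ⟨fun h i _ => ⟨h.1 i, h.2 i⟩, fun h =>
      ⟨fun i => (h i trivial).1, fun i => (h i trivial).2⟩⟩
  rw [h]
  exact isCompact_univ_pi fun _ => isCompact_stdSimplex ℝ n

theorem Matrix.norm_mulVec_le_of_mem_rowStochastic {n : Type*} [Fintype n] [DecidableEq n]
    {M : Matrix n n ℝ} (hM : M ∈ Matrix.rowStochastic ℝ n) (v : n → ℝ) :
    ‖M.mulVec v‖ ≤ ‖v‖ := by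
  refine (pi_norm_le_iff_of_nonneg (norm_nonneg v)).2 fun i => ?_
  calc ‖M.mulVec v i‖ ≤ ∑ j, ‖M i j * v j‖ := norm_sum_le _ _
    _ ≤ ∑ j, M i j * ‖v‖ := Finset.sum_le_sum fun j _ => by
        rw [norm_mul, Real.norm_of_nonneg (Matrix.nonneg_of_mem_rowStochastic hM)]
        exact mul_le_mul_of_nonneg_left (norm_le_pi_norm v j)
          (Matrix.nonneg_of_mem_rowStochastic hM)
    _ = ‖v‖ := by rw [← Finset.sum_mul, Matrix.sum_row_of_mem_rowStochastic hM, one_mul]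

theorem mem_polytope_iff {N : ℕ} {A : ℝ → Matrix (Fin N) (Fin N) ℝ} {t τ : ℝ} {x : Fin N → ℝ} :
    x ∈ polytope A t τ ↔
      ∃ w ∈ stdSimplex ℝ (Fin N), Matrix.vecMul w (stateTransition A t τ) = x := by
  rw [polytope, Matrix.convexHull_range_col_transpose]; rfl

theorem isCompact_polytope {N : ℕ} (A : ℝ → Matrix (Fin N) (Fin N) ℝ) (t τ : ℝ) :
    IsCompact (polytope A t τ) :=
  (finite_range _).isCompact_convexHull ℝ

theorem convex_limitPolytope {N : ℕ} (A : ℝ → Matrix (Fin N) (Fin N) ℝ) (τ : ℝ) :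
    Convex ℝ (limitPolytope A τ) :=
  convex_iInter₂ fun _ _ => convex_convexHull ℝ _

theorem limitPolytope_subset {N : ℕ} {A : ℝ → Matrix (Fin N) (Fin N) ℝ} {t τ : ℝ} (ht : τ ≤ t) :
    limitPolytope A τ ⊆ polytope A t τ :=
  iInter₂_subset t ht

/-! ### The limit polytope and its vertices. -/

namespace IsIntensityChain

variable {N : ℕ} {A : ℝ → Matrix (Fin N) (Fin N) ℝ} {τ : ℝ} {u : ℕ → ℝ}
  {Q : Matrix (Fin N) (Fin N) ℝ}

theorem polytope_antitoneOn (hA : IsIntensityChain A) (hτ : 0 ≤ τ) :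
    AntitoneOn (fun t => polytope A t τ) (Ici τ) := by
  intro s hs t _ hst x hx
  have hs0 : 0 ≤ s := hτ.trans hs
  obtain ⟨w, hw, rfl⟩ := mem_polytope_iff.1 hx
  have hM := hA.stateTransition_mem_rowStochastic hs0 hst
  refine mem_polytope_iff.2 ⟨Matrix.vecMul w (stateTransition A t s), ?_, ?_⟩
  · refine ⟨Matrix.nonneg_vecMul_of_mem_rowStochastic hM hw.1, ?_⟩
    simp only [Matrix.vecMul, dotProduct]
    rw [Finset.sum_comm]
    simp only [← Finset.mul_sum, Matrix.sum_row_of_mem_rowStochastic hM, mul_one, hw.2]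
  · rw [Matrix.vecMul_vecMul, stateTransition_mul hA.locallyIntegrable hτ hs0 (hs0.trans hst)]

/-- A decreasing family of compact sets eventually enters any open neighbourhood of its
intersection, here the `ε`-thickening; the other inclusion is free. -/
theorem tendsto_hausdorffEDist_polytope (hA : IsIntensityChain A) (hτ : 0 ≤ τ) :
    Tendsto (fun t => Metric.hausdorffEDist (polytope A t τ) (limitPolytope A τ)) atTop
      (𝓝 0) := by
  rw [ENNReal.tendsto_nhds_zero]
  intro ε hε
  have hanti := hA.polytope_antitoneOn hτ
  set U : Set (Fin N → ℝ) := {x | Metric.infEDist x (limitPolytope A τ) < ε}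
  have hU : IsOpen U := isOpen_lt Metric.continuous_infEDist continuous_const
  obtain ⟨⟨s, hs⟩, hsU⟩ : ∃ s : Ici τ, polytope A s τ ⊆ U := by
    have : Nonempty (Ici τ) := ⟨⟨τ, self_mem_Ici⟩⟩
    refine exists_subset_nhds_of_isCompact (V := fun s : Ici τ => polytope A s τ) ?_
      (fun s => isCompact_polytope A s τ) fun x hx => ?_
    · intro a b
      exact ⟨a ⊔ b, hanti a.2 (a ⊔ b).2 (le_sup_left (a := a)),
        hanti b.2 (a ⊔ b).2 (le_sup_right (a := a))⟩
    · have hx : x ∈ limitPolytope A τ := mem_iInter₂.2 fun s hs => mem_iInter.1 hx ⟨s, hs⟩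
      refine hU.mem_nhds ?_
      change Metric.infEDist x (limitPolytope A τ) < ε
      rwa [Metric.infEDist_zero_of_mem (s := limitPolytope A τ) hx]
  filter_upwards [eventually_ge_atTop s] with t ht
  have ht' : τ ≤ t := le_trans hs ht
  refine Metric.hausdorffEDist_le_of_infEDist (fun x hx => (hsU (hanti hs ht' ht hx)).le)
    fun x hx => ?_
  rw [Metric.infEDist_zero_of_mem (limitPolytope_subset ht' hx)]
  exact zero_le

theorem exists_tendsto_stateTransition (hA : IsIntensityChain A) (hτ : 0 ≤ τ) :
    ∃ (u : ℕ → ℝ) (Q : Matrix (Fin N) (Fin N) ℝ), (∀ k, τ ≤ u k) ∧ Tendsto u atTop atTop ∧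
      Tendsto (fun k => stateTransition A (u k) τ) atTop (𝓝 Q) := by
  have hle : ∀ k : ℕ, τ ≤ τ + k := fun k => by simp
  have : FirstCountableTopology (Matrix (Fin N) (Fin N) ℝ) :=
    inferInstanceAs (FirstCountableTopology (Fin N → Fin N → ℝ))
  obtain ⟨Q, -, φ, hφ, hQ⟩ := Matrix.isCompact_rowStochastic.tendsto_subseq
    (x := fun k : ℕ => stateTransition A (τ + k) τ)
    fun k => hA.stateTransition_mem_rowStochastic hτ (hle k)
  exact ⟨fun k => τ + φ k, Q, fun k => hle _, tendsto_const_nhds.add_atTop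
    (tendsto_natCast_atTop_atTop.comp hφ.tendsto_atTop), hQ⟩

theorem row_mem_limitPolytope (hA : IsIntensityChain A) (hτ : 0 ≤ τ) (hu : Tendsto u atTop atTop)
    (hQ : Tendsto (fun k => stateTransition A (u k) τ) atTop (𝓝 Q)) (i : Fin N) :
    Q i ∈ limitPolytope A τ := by
  refine mem_iInter₂.2 fun t ht => ?_
  refine (isCompact_polytope A t τ).isClosed.mem_of_tendsto (tendsto_pi_nhds.1 hQ i) ?_
  filter_upwards [hu.eventually_ge_atTop t] with k hk
  exact hA.polytope_antitoneOn hτ ht (le_trans ht hk) hk (subset_convexHull ℝ _ ⟨i, rfl⟩)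

/-- A family of points of the limit polytope has barycentric coordinates with respect to the limit
rows which are limits of barycentric coordinates with respect to the approximating rows. -/
theorem exists_tendsto_weights (hu : ∀ k, τ ≤ u k)
    (hQ : Tendsto (fun k => stateTransition A (u k) τ) atTop (𝓝 Q)) {ι : Type*} [Finite ι]
    {x : ι → Fin N → ℝ} (hx : ∀ a, x a ∈ limitPolytope A τ) :
    ∃ (W : ℕ → ι → Fin N → ℝ) (L : ι → Fin N → ℝ) (φ : ℕ → ℕ), Tendsto W atTop (𝓝 L) ∧
      (∀ k a, Matrix.vecMul (W k a) (stateTransition A (u (φ k)) τ) = x a) ∧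
      (∀ a, L a ∈ stdSimplex ℝ (Fin N)) ∧ ∀ a, Matrix.vecMul (L a) Q = x a := by
  choose W hW hWx using fun k a => mem_polytope_iff.1 (limitPolytope_subset (hu k) (hx a))
  obtain ⟨L, hL, φ, hφ, hlim⟩ :=
    (isCompact_univ_pi fun _ : ι => isCompact_stdSimplex ℝ (Fin N)).tendsto_subseq
      (x := W) fun k a _ => hW k a
  refine ⟨W ∘ φ, L, φ, hlim, fun k a => hWx _ _, fun a => hL a trivial, fun a => ?_⟩
  have hcont : Continuous fun p : (Fin N → ℝ) × Matrix (Fin N) (Fin N) ℝ =>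
      Matrix.vecMul p.1 p.2 := continuous_fst.matrix_vecMul continuous_snd
  have h := (hcont.tendsto (L a, Q)).comp
    ((tendsto_pi_nhds.1 hlim a).prodMk_nhds (hQ.comp hφ.tendsto_atTop))
  refine tendsto_nhds_unique h (tendsto_const_nhds.congr fun k => ?_)
  exact (hWx _ _).symm

theorem limitPolytope_eq_convexHull (hA : IsIntensityChain A) (hτ : 0 ≤ τ) (hu : ∀ k, τ ≤ u k)
    (hu' : Tendsto u atTop atTop)
    (hQ : Tendsto (fun k => stateTransition A (u k) τ) atTop (𝓝 Q)) :
    limitPolytope A τ = convexHull ℝ (range Q) := by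
  refine Subset.antisymm (fun x hx => ?_) (convexHull_min ?_ (convex_limitPolytope A τ))
  · obtain ⟨-, L, -, -, -, hL, hLx⟩ := exists_tendsto_weights hu hQ (ι := Unit) fun _ => hx
    have h := Matrix.convexHull_range_col_transpose Q
    change convexHull ℝ (range Q) = _ at h
    exact h ▸ ⟨L (), hL (), hLx ()⟩
  · rintro _ ⟨i, rfl⟩
    exact hA.row_mem_limitPolytope hτ hu' hQ i

theorem exists_finset_limitPolytope_eq (hA : IsIntensityChain A) (hτ : 0 ≤ τ) :
    ∃ F : Finset (Fin N → ℝ), limitPolytope A τ = convexHull ℝ (F : Set (Fin N → ℝ)) := by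
  obtain ⟨u, Q, hu, hu', hQ⟩ := hA.exists_tendsto_stateTransition hτ
  refine ⟨(finite_range Q).toFinset, ?_⟩
  rw [(finite_range Q).coe_toFinset]
  exact hA.limitPolytope_eq_convexHull hτ hu hu' hQ

theorem limitVertices_finite (hA : IsIntensityChain A) (hτ : 0 ≤ τ) :
    (limitVertices A τ).Finite := by
  obtain ⟨F, hF⟩ := hA.exists_finset_limitPolytope_eq hτ
  rw [limitVertices, hF]
  exact F.finite_toSet.subset extremePoints_convexHull_subset

theorem convexHull_limitVertices (hA : IsIntensityChain A) (hτ : 0 ≤ τ) :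
    convexHull ℝ (limitVertices A τ) = limitPolytope A τ := by
  obtain ⟨F, hF⟩ := hA.exists_finset_limitPolytope_eq hτ
  have hc : IsCompact (limitPolytope A τ) := hF ▸ F.finite_toSet.isCompact_convexHull ℝ
  rw [← closure_convexHull_extremePoints hc (convex_limitPolytope A τ)]
  exact ((hA.limitVertices_finite hτ).isClosed_convexHull ℝ).closure_eq.symm

theorem linearIndependent_limitVertices (hA : IsIntensityChain A) (hτ : 0 ≤ τ) :
    LinearIndependent ℝ (fun v : limitVertices A τ => (v : Fin N → ℝ)) := by
  obtain ⟨u, Q, hu, hu', hQ⟩ := hA.exists_tendsto_stateTransition hτ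
  have := (hA.limitVertices_finite hτ).to_subtype
  have := Fintype.ofFinite (limitVertices A τ)
  obtain ⟨W, L, φ, hW, hWx, hL, hLx⟩ := exists_tendsto_weights hu hQ
    (x := fun v : limitVertices A τ => (v : Fin N → ℝ)) fun v => extremePoints_subset v.2
  have hsupp : ∀ v j, 0 < L v j → Q j = v := fun v j hj =>
    eq_of_mem_extremePoints_of_sum_smul_eq (convex_limitPolytope A τ) v.2 (hL v)
      (fun i => hA.row_mem_limitPolytope hτ hu' hQ i)
      (by rw [← hLx v, Matrix.vecMul_eq_sum]) hj
  rw [Fintype.linearIndependent_iff]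
  intro g hg v
  -- Invertibility at finite times lifts the relation to the weights; `Q` itself may be singular.
  have hW0 : ∀ k, ∑ a, g a • W k a = 0 := by
    intro k
    apply Matrix.vecMul_injective_of_isUnit
      (hA.isUnit_stateTransition hτ (hτ.trans (hu (φ k))))
    simp only [Matrix.sum_vecMul, Matrix.smul_vecMul, hWx, hg, Matrix.zero_vecMul]
  have hL0 : ∑ a, g a • L a = 0 := by
    refine tendsto_nhds_unique (tendsto_finsetSum Finset.univ fun a _ =>
      (tendsto_pi_nhds.1 hW a).const_smul (g a)) ?_
    simp only [hW0, tendsto_const_nhds]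
  obtain ⟨j, hj⟩ : ∃ j, 0 < L v j := by
    by_contra! h
    have := (hL v).2
    rw [Finset.sum_eq_zero fun j _ => le_antisymm (h j) ((hL v).1 j)] at this
    exact zero_ne_one this
  have hj0 := congrFun hL0 j
  -- Any other vertex charging row `j` would also equal `Q j = v`.
  rw [Finset.sum_apply, Finset.sum_eq_single v] at hj0
  · exact (mul_eq_zero.1 hj0).resolve_right hj.ne'
  · intro a _ hav
    have : L a j = 0 := by
      refine le_antisymm (not_lt.1 fun h => hav ?_) ((hL a).1 j)
      exact Subtype.ext ((hsupp a j h).symm.trans (hsupp v j hj))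
    simp [this]
  · simp

/-! ### The null space and the rank. -/

theorem norm_stateTransition_mulVec_le (hA : IsIntensityChain A) (hτ : 0 ≤ τ) {s t : ℝ}
    (hs : τ ≤ s) (ht : s ≤ t) (v : Fin N → ℝ) :
    ‖(stateTransition A t τ).mulVec v‖ ≤ ‖(stateTransition A s τ).mulVec v‖ := by
  have hs0 := hτ.trans hs
  rw [← stateTransition_mul hA.locallyIntegrable hτ hs0 (hs0.trans ht), ← Matrix.mulVec_mulVec]
  exact Matrix.norm_mulVec_le_of_mem_rowStochastic
    (hA.stateTransition_mem_rowStochastic hs0 ht) _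

theorem mem_nullSpace_iff (hA : IsIntensityChain A) (hτ : 0 ≤ τ) {v : Fin N → ℝ} :
    v ∈ nullSpace A τ ↔ ∀ x ∈ limitVertices A τ, x ⬝ᵥ v = 0 := by
  obtain ⟨u, Q, hu, hu', hQ⟩ := hA.exists_tendsto_stateTransition hτ
  have hcont : Continuous fun M : Matrix (Fin N) (Fin N) ℝ => M.mulVec v :=
    continuous_id.matrix_mulVec continuous_const
  have hQv := (hcont.tendsto Q).comp hQ
  constructor
  · intro hv x hx
    change Tendsto (fun t => (stateTransition A t τ).mulVec v) atTop (𝓝 0) at hv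
    have hQ0 : Q.mulVec v = 0 := tendsto_nhds_unique hQv (hv.comp hu')
    obtain ⟨-, L, -, -, -, -, hLx⟩ := exists_tendsto_weights hu hQ (ι := Unit) (x := fun _ => x)
      fun _ => extremePoints_subset hx
    rw [← hLx (), ← Matrix.dotProduct_mulVec, hQ0, dotProduct_zero]
  · intro hv
    have hC : ∀ x ∈ limitPolytope A τ, x ⬝ᵥ v = 0 := by
      rw [← hA.convexHull_limitVertices hτ]
      refine convexHull_min (t := {x | x ⬝ᵥ v = 0}) hv ?_
      intro x hx y hy a b _ _ _
      simp only [mem_ofPred_eq] at hx hy ⊢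
      rw [add_dotProduct, smul_dotProduct, smul_dotProduct, hx, hy, smul_zero, smul_zero, add_zero]
    have hQ0 : Q.mulVec v = 0 := funext fun i => hC _ (hA.row_mem_limitPolytope hτ hu' hQ i)
    rw [hQ0] at hQv
    change Tendsto (fun t => (stateTransition A t τ).mulVec v) atTop (𝓝 0)
    rw [Metric.tendsto_atTop] at hQv ⊢
    intro ε hε
    -- One time `u k` with small norm suffices, since the norm never increases afterwards.
    obtain ⟨k, hk⟩ := hQv ε hε
    refine ⟨u k, fun t ht => ?_⟩
    have := hk k le_rfl
    rw [dist_zero_right] at this ⊢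
    exact (hA.norm_stateTransition_mulVec_le hτ (hu k) ht v).trans_lt this

/-- The null space is the kernel of the matrix whose rows are the vertices, which has full row rank.
-/
theorem ncard_limitVertices_add_finrank_nullSpace (hA : IsIntensityChain A) (hτ : 0 ≤ τ) :
    (limitVertices A τ).ncard + Module.finrank ℝ (nullSpace A τ) = N := by
  have := (hA.limitVertices_finite hτ).to_subtype
  have := Fintype.ofFinite (limitVertices A τ)
  let M : Matrix (limitVertices A τ) (Fin N) ℝ := Matrix.of fun v => v
  have hM : M.rank = Fintype.card (limitVertices A τ) :=
    (hA.linearIndependent_limitVertices hτ).rank_matrix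
  have hker : nullSpace A τ = LinearMap.ker M.mulVecLin := by
    ext v
    rw [hA.mem_nullSpace_iff hτ, LinearMap.mem_ker, Matrix.mulVecLin_apply]
    exact ⟨fun h => funext fun x => h x x.2, fun h x hx => congrFun h ⟨x, hx⟩⟩
  rw [← Nat.card_coe_set_eq, Nat.card_eq_fintype_card, ← hM, hker, Matrix.rank,
    LinearMap.finrank_range_add_finrank_ker, Module.finrank_fin_fun]

/-- `Φ(τ, 0)` carries the null space at time `0` isomorphically onto the one at `τ`. -/
theorem finrank_nullSpace (hA : IsIntensityChain A) (hτ : 0 ≤ τ) :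
    Module.finrank ℝ (nullSpace A τ) = nullity A := by
  let e : (Fin N → ℝ) ≃ₗ[ℝ] (Fin N → ℝ) :=
    LinearEquiv.ofBijective (stateTransition A τ 0).mulVecLin
      ⟨Matrix.mulVec_injective_of_isUnit (hA.isUnit_stateTransition le_rfl hτ),
        Matrix.mulVec_surjective_iff_isUnit.2 (hA.isUnit_stateTransition le_rfl hτ)⟩
  have hmem : ∀ v, e v ∈ nullSpace A τ ↔ v ∈ nullSpace A 0 := fun v => by
    refine tendsto_congr' ?_
    filter_upwards [eventually_ge_atTop τ] with t ht
    change (stateTransition A t τ).mulVec ((stateTransition A τ 0).mulVec v) = _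
    rw [Matrix.mulVec_mulVec, stateTransition_mul hA.locallyIntegrable le_rfl hτ (hτ.trans ht)]
  have hmap : nullSpace A τ = (nullSpace A 0).map (e : (Fin N → ℝ) →ₗ[ℝ] (Fin N → ℝ)) := by
    ext v
    rw [Submodule.mem_map_equiv, ← hmem, LinearEquiv.apply_symm_apply]
  rw [hmap, nullity]
  exact e.finrank_map_eq _

end IsIntensityChain

theorem theorem2 {N : ℕ} (A : ℝ → Matrix (Fin N) (Fin N) ℝ) (hA : IsIntensityChain A) :
    (∀ τ, 0 ≤ τ → Module.finrank ℝ (nullSpace A τ) = nullity A) ∧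
    ∃ c : ℕ,
      (∀ τ, 0 ≤ τ →
        AntitoneOn (fun t => polytope A t τ) (Ici τ) ∧
        Tendsto (fun t => Metric.hausdorffEDist (polytope A t τ) (limitPolytope A τ))
          atTop (𝓝 0) ∧
        (∃ F : Finset (Fin N → ℝ), limitPolytope A τ = convexHull ℝ (F : Set (Fin N → ℝ))) ∧
        (limitVertices A τ).Finite ∧
        (limitVertices A τ).ncard = c ∧
        LinearIndependent ℝ (fun v : limitVertices A τ => (v : Fin N → ℝ))) ∧
      chainRank A = c := by
  refine ⟨fun τ hτ => hA.finrank_nullSpace hτ, chainRank A, fun τ hτ =>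
    ⟨hA.polytope_antitoneOn hτ, hA.tendsto_hausdorffEDist_polytope hτ,
      hA.exists_finset_limitPolytope_eq hτ, hA.limitVertices_finite hτ, ?_,
      hA.linearIndependent_limitVertices hτ⟩, rfl⟩
  have h := hA.ncard_limitVertices_add_finrank_nullSpace hτ
  rw [hA.finrank_nullSpace hτ] at h
  rw [chainRank]
  omega
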